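/- Let $k,n\ge 0$ be integers and let $L^{(1)},\dots,L^{(k)}$ be independent real random variables following the logistic distribution with density $\frac{\pi}{2}\operatorname{sech}^2(\pi u)$, $u\in\mathbb R$; write $\imath=\sqrt{-1}$. For $\mathbf a=(a_1,\dots,a_k)\in\mathbb R^k$ and $x\in\mathbb R$, the Nörlund (higher-order Bernoulli) polynomials are defined by the generating function $$\sum_{n\ge 0}B_n^{(k)}(x|\mathbf a)\frac{t^n}{n!}=e^{xt}\prod_{j=1}^k\frac{a_jt}{e^{a_jt}-1}$$ (a factor with $a_j=0$ being read as $1$), and the higher-order Bernoulli numbers by $B_n^{(k)}(\mathbf a)=B_n^{(k)}(0|\mathbf a)$. For a prime $p$, the Volkenborn integral of $h:\mathbb Z_p\to\mathbb C_p$ is $\int_{\mathbb Z_p}h\,d\mu_0=\lim_{N\to\infty}p^{-N}\sum_{y=0}^{p^N-1}h(y)$ when the limit exists, and the integral over $\mathbb Z_p^k$ is the $k$-fold iterated integral. Put $|\mathbf x|=x_1+\dots+x_k$. All expectations below are of integrable variables. (1) For all $\mathbf a\in\mathbb R^k$, $x\in\mathbb R$, $n\ge0$, $$B_n^{(k)}(x|\mathbf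 a)=\mathbb E\Big(x+\sum_{j=1}^k a_j\big(\imath L^{(j)}-\tfrac12\big)\Big)^n .$$ (2) For all $\mathbf a\in\mathbb R^k$, $n\ge0$, $$B_n^{(k)}(\mathbf a)=\mathbb E\Big(\sum_{j=1}^k a_j\big(\imath L^{(j)}-\tfrac12\big)\Big)^n .$$ (3) The multivariate Volkenborn integral satisfies $$\int_{\mathbb Z_p^k}f(|\mathbf x+\mathbf y|)\,d\mu_0(\mathbf y)=\mathbb E f\Big(\sum_{j=1}^k\big(x_j+\imath L^{(j)}-\tfrac12\big)\Big)$$ in the following sense. Let $K$ be a field with embeddings $\sigma:K\to\mathbb C$ and $\tau:K\to\mathbb C_p$ (for instance $K=\mathbb Q$, or $K=\mathbb R$ with any embedding $\mathbb R\to\mathbb C_p$), and let $\mathbf x\in K^k$. The left side is evaluated in $\mathbb C_p$ through $\tau$ and the right side in $\mathbb C$ through $\sigma$. (3a) If $f\in K[X]$, then there is $v\in K$ such that the left side exists and equals $\tau(v)$, and the right side exists and equals $\sigma(v)$. (3b) If $f(u)=\sum_n c_nu^n$ is a power series over $K$, then the identity for $u\mapsto f(tu)$ holds as an identity of power series in $t$: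 there is one power series $g(t)=\sum_n g_nt^n$ over $K$ such that - for every $t\in\mathbb C_p$ with $|\tau(c_n)|_p\,\big(|t|_p\max(1,|\tau(|\mathbf x|)|_p)\big)^n\to0$, the integral $\int_{\mathbb Z_p^k}f(t|\mathbf x+\mathbf y|)\,d\mu_0(\mathbf y)$ exists and equals the convergent sum $\sum_n\tau(g_n)t^n$ (so for all small $t$ if $f$ is $p$-adically analytic in a neighbourhood of $0$); - for every $t\in\mathbb C$ for which there are real $C$ and $A<2\pi$ with $n!\,|\sigma(c_n)|\,|t|^n\le CA^n$ for all $n$ (that is, $u\mapsto f(tu)$ is entire of exponential type less than $2\pi$), the expectation $\mathbb E f\big(t\sum_{j}(x_j+\imath L^{(j)}-\frac12)\big)$ exists and equals the convergent sum $\sum_n\sigma(g_n)t^n$. -/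

import Mathlib

open MeasureTheory ProbabilityTheory Filter Topology
open scoped Nat PowerSeries

/-- The power series `(e^{at} - 1) / (at) = ∑ aⁿ tⁿ / (n + 1)!`
(equal to `1` for `a = 0`). -/
noncomputable def expQuotient {K : Type*} [Field K] (a : K) : K⟦X⟧ :=
  PowerSeries.mk fun n => a ^ n / ((n + 1)! : K)

/-- The power series `at / (e^{at} - 1)` (equal to `1` for `a = 0`). -/
noncomputable def bernoulliFactor {K : Type*} [Field K] (a : K) : K⟦X⟧ :=
  (expQuotient a)⁻¹

/-- `bernoulliFactor a * (e^{at} - 1) = at`. -/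
theorem bernoulliFactor_mul {K : Type*} [Field K] [CharZero K] (a : K) :
    bernoulliFactor a * (PowerSeries.mk (fun n => a ^ n / (n ! : K)) - 1) =
      PowerSeries.C a * PowerSeries.X := by
  have h : PowerSeries.mk (fun n => a ^ n / (n ! : K)) - 1 =
      PowerSeries.C a * PowerSeries.X * expQuotient a := by
    ext n
    cases n with
    | zero => simp
    | succ n => simp [expQuotient, mul_assoc, PowerSeries.coeff_succ_X_mul,
        PowerSeries.coeff_one, pow_succ]; ring
  have h0 : PowerSeries.constantCoeff (expQuotient a) ≠ 0 := by
    simp [expQuotient, ← PowerSeries.coeff_zero_eq_constantCoeff_apply]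
  rw [h, mul_left_comm, bernoulliFactor, PowerSeries.inv_mul_cancel _ h0, mul_one]

/-- The generating function `e^{xt} ∏ⱼ aⱼ t / (e^{aⱼ t} - 1)`, as a power series in `t`. -/
noncomputable def norlundSeries {K : Type*} [Field K] {k : ℕ} (a : Fin k → K) (x : K) : K⟦X⟧ :=
  PowerSeries.mk (fun n => x ^ n / (n ! : K)) * ∏ j, bernoulliFactor (a j)

/-- The value at `x` of the Nörlund (higher-order Bernoulli) polynomial `B_n^{(k)}(x | a)`:
`∑ₙ B_n^{(k)}(x | a) tⁿ / n! = e^{xt} ∏ⱼ aⱼ t / (e^{aⱼ t} - 1)`. -/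
noncomputable def norlundPoly {K : Type*} [Field K] {k : ℕ} (n : ℕ) (a : Fin k → K) (x : K) : K :=
  (n ! : K) * PowerSeries.coeff n (norlundSeries a x)

/-- The higher-order Bernoulli number `B_n^{(k)}(a) = B_n^{(k)}(0 | a)`. -/
noncomputable def norlundNumber {K : Type*} [Field K] {k : ℕ} (n : ℕ) (a : Fin k → K) : K :=
  norlundPoly n a 0

/-- The logistic distribution on `ℝ`, with density `(π / 2) sech² (π x)`. -/
noncomputable def logisticMeasure : Measure ℝ :=
  volume.withDensity fun x => ENNReal.ofReal (Real.pi / 2 * (1 / Real.cosh (Real.pi * x)) ^ 2)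

section Volkenborn

variable (p : ℕ) [Fact p.Prime]

/-- The canonical embedding of `ℤ_p` into `ℂ_p`. -/
noncomputable def padicIntToComplex : ℤ_[p] →+* PadicComplex p :=
  (algebraMap (PadicAlgCl p) (PadicComplex p)).comp
    ((algebraMap ℚ_[p] (PadicAlgCl p)).comp PadicInt.Coe.ringHom)

/-- `f : ℤ_p → ℂ_p` has Volkenborn integral `v`:
`v = lim_{N → ∞} p^{-N} ∑_{y = 0}^{p^N - 1} f(y)`, the limit existing. -/
def HasVolkenbornIntegral (f : ℤ_[p] → PadicComplex p) (v : PadicComplex p) : Prop :=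
  Tendsto (fun N : ℕ => ((p : PadicComplex p) ^ N)⁻¹ * ∑ y ∈ Finset.range (p ^ N), f (y : ℤ_[p]))
    atTop (𝓝 v)

/-- `f : ℤ_p^k → ℂ_p` has the iterated Volkenborn integral `v = ∫ ⋯ ∫ f(y₁, …, y_k)`,
all the successive integrals existing. -/
def HasMultiVolkenbornIntegral :
    (k : ℕ) → ((Fin k → ℤ_[p]) → PadicComplex p) → PadicComplex p → Prop
  | 0, f, v => f Fin.elim0 = v
  | k + 1, f, v => ∃ g : ℤ_[p] → PadicComplex p,
      (∀ y, HasMultiVolkenbornIntegral k (fun z => f (Fin.cons y z)) (g y)) ∧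
        HasVolkenbornIntegral p g v

end Volkenborn

/-! Everything reduces to the series `t / (e^t - 1)`, which arises once from the logistic law and
once from Volkenborn integration.

Probabilistic side: the substitution `v = sigmoid (2πx)` turns the Laplace transform of `L` into the
Beta integral `B(1+z, 1-z) = πz / sin πz`, so `E e^{t(iL - 1/2)} = t / (e^t - 1)` for `|Im t| < 2π`.
Hence `iL - 1/2` has this moment series (`hasMomentSeries_logistic`). Scaling by `a` rescales it and
independence multiplies such series, which gives the Nörlund series.

p-adic side: by Faulhaber's formula the Riemann sums of `y^m` tend to `B_m`, so one integration
multiplies the generating function by `t / (e^t - 1)` and raises the order of the Nörlund polynomial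
by one (`hasVolkenbornIntegral_norlundPoly`).

Thus for `f = u^n` both sides are the Nörlund polynomial with all parameters 1 at `|x|`, an element
of `K` that commutes with embeddings (`map_norlundPoly`). Series are integrated term by term: over
`ℂ` by exponential moments of order below `2π`, over `ℂ_p` by the bound `p^k R^n` of
`norm_norlundPoly_one_le`, whose source is that the Riemann sums of all powers are bounded by `p`.
-/

/-! ### Exponential generating functions and formal properties of Nörlund polynomials. -/

section ExponentialGeneratingFunctions

variable {K : Type*} [Field K]

/-- The exponential generating function `∑ uₙ tⁿ / n!`. -/
noncomputable def egf (u : ℕ → K) : K⟦X⟧ :=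
  PowerSeries.mk fun n => u n / (n ! : K)

theorem coeff_egf (u : ℕ → K) (n : ℕ) : (egf u).coeff n = u n / (n ! : K) := by
  simp [egf]

theorem norlundSeries_eq {k : ℕ} (a : Fin k → K) (x : K) :
    norlundSeries a x = egf (x ^ ·) * ∏ j, bernoulliFactor (a j) := rfl

variable [CharZero K]

theorem egf_injective : Function.Injective (egf : (ℕ → K) → K⟦X⟧) := by
  intro u v h
  ext n
  have hn : (n ! : K) ≠ 0 := by exact_mod_cast n.factorial_ne_zero
  have := congrArg (PowerSeries.coeff n) h
  rw [coeff_egf, coeff_egf] at this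
  field_simp at this
  exact this

theorem egf_mul (u v : ℕ → K) :
    egf u * egf v =
      egf fun n => ∑ ij ∈ Finset.HasAntidiagonal.antidiagonal n, (n.choose ij.1 : K) * u ij.1 * v ij.2 := by
  ext n
  rw [PowerSeries.coeff_mul, coeff_egf, Finset.sum_div]
  refine Finset.sum_congr rfl fun ij hij => ?_
  obtain ⟨i, j⟩ := ij
  obtain rfl := Finset.HasAntidiagonal.mem_antidiagonal.1 hij
  have h : ((i + j).choose i : K) * (i ! : K) * (j ! : K) = ((i + j)! : K) := by
    exact_mod_cast Nat.choose_symm_add (a := i) (b := j) ▸ Nat.add_choose_mul_factorial_mul_factorial i j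
  have hi : (i ! : K) ≠ 0 := by exact_mod_cast i.factorial_ne_zero
  have hj : (j ! : K) ≠ 0 := by exact_mod_cast j.factorial_ne_zero
  have hij : ((i + j)! : K) ≠ 0 := by exact_mod_cast (i + j).factorial_ne_zero
  simp only [coeff_egf]
  rw [div_mul_div_comm, div_eq_div_iff (mul_ne_zero hi hj) hij, ← h]
  ring

theorem egf_pow_mul_egf_pow (x y : K) : egf (x ^ ·) * egf (y ^ ·) = egf ((x + y) ^ ·) := by
  rw [egf_mul]
  congr 1
  ext n
  rw [(Commute.all x y).add_pow']
  refine Finset.sum_congr rfl fun ij _ => ?_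
  simp [mul_assoc]

theorem egf_norlundPoly {k : ℕ} (a : Fin k → K) (x : K) :
    egf (fun n => norlundPoly n a x) = norlundSeries a x := by
  ext n
  have hn : (n ! : K) ≠ 0 := by exact_mod_cast n.factorial_ne_zero
  rw [coeff_egf, norlundPoly, mul_div_cancel_left₀ _ hn]

/-- The variable enters the generating function only through `e^{xt}`, so a shift by `y` multiplies
it by `e^{yt}`. -/
theorem norlundPoly_add {k : ℕ} (n : ℕ) (a : Fin k → K) (x y : K) :
    norlundPoly n a (x + y) =
      ∑ ij ∈ Finset.HasAntidiagonal.antidiagonal n, (n.choose ij.1 : K) * norlundPoly ij.1 a x * y ^ ij.2 := by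
  have h : egf (fun n => norlundPoly n a (x + y)) =
      egf (fun n => norlundPoly n a x) * egf (y ^ ·) := by
    rw [egf_norlundPoly, egf_norlundPoly, norlundSeries_eq, norlundSeries_eq,
      ← egf_pow_mul_egf_pow]
    ring
  rw [egf_mul] at h
  exact congrFun (egf_injective h) n

theorem constantCoeff_expQuotient (a : K) : PowerSeries.constantCoeff (expQuotient a) ≠ 0 := by
  simp [expQuotient, ← PowerSeries.coeff_zero_eq_constantCoeff_apply]

theorem eq_bernoulliFactor_iff (a : K) (q : K⟦X⟧) :
    q = bernoulliFactor a ↔ q * expQuotient a = 1 := by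
  rw [bernoulliFactor, PowerSeries.eq_inv_iff_mul_eq_one (constantCoeff_expQuotient a)]

/-- Both series solve `q (e^t - 1) = t`, and `e^t - 1` is a nonzero element of a domain. -/
theorem bernoulliFactor_one_eq_egf : bernoulliFactor (1 : K) = egf fun n => (bernoulli n : K) := by
  have h1 := bernoulliFactor_mul (1 : K)
  have h2 := bernoulliPowerSeries_mul_exp_sub_one K
  have h3 : PowerSeries.mk (fun n => (1 : K) ^ n / (n ! : K)) = PowerSeries.exp K := by
    ext n
    simp [PowerSeries.coeff_exp]
  have h4 : PowerSeries.exp K - 1 ≠ 0 := by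
    intro h
    rw [h, mul_zero] at h2
    exact PowerSeries.X_ne_zero h2.symm
  rw [h3, map_one, one_mul, ← h2] at h1
  rw [mul_right_cancel₀ h4 h1]
  ext n
  simp [bernoulliPowerSeries, coeff_egf]

/-- This is the expansion of `norlundPoly_add` with `y^j` replaced by `B_j`, which is exactly what
integrating over `y` does. -/
theorem norlundPoly_succ_one (n k : ℕ) (x : K) :
    norlundPoly n (fun _ : Fin (k + 1) => (1 : K)) x =
      ∑ ij ∈ Finset.HasAntidiagonal.antidiagonal n, (n.choose ij.1 : K) *
        norlundPoly ij.1 (fun _ : Fin k => (1 : K)) x * (bernoulli ij.2 : K) := by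
  have h : egf (fun n => norlundPoly n (fun _ : Fin (k + 1) => (1 : K)) x) =
      egf (fun n => norlundPoly n (fun _ : Fin k => (1 : K)) x) *
        egf fun n => (bernoulli n : K) := by
    rw [egf_norlundPoly, egf_norlundPoly, norlundSeries_eq, norlundSeries_eq,
      ← bernoulliFactor_one_eq_egf, Fin.prod_univ_castSucc, mul_assoc]
  rw [egf_mul] at h
  exact congrFun (egf_injective h) n

theorem norlundPoly_fin_zero (n : ℕ) (a : Fin 0 → K) (x : K) : norlundPoly n a x = x ^ n := by
  have hn : (n ! : K) ≠ 0 := by exact_mod_cast n.factorial_ne_zero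
  simp [norlundPoly, norlundSeries, mul_div_cancel₀ _ hn]

theorem map_bernoulliFactor {F : Type*} [Field F] [CharZero F] (σ : K →+* F) (a : K) :
    PowerSeries.map σ (bernoulliFactor a) = bernoulliFactor (σ a) := by
  rw [eq_bernoulliFactor_iff]
  have h : expQuotient (σ a) = PowerSeries.map σ (expQuotient a) := by
    ext n
    simp [expQuotient]
  rw [h, ← map_mul, (eq_bernoulliFactor_iff a _).1 rfl, map_one]

theorem map_norlundPoly {F : Type*} [Field F] [CharZero F] (σ : K →+* F) {k : ℕ} (n : ℕ)
    (a : Fin k → K) (x : K) : σ (norlundPoly n a x) = norlundPoly n (fun j => σ (a j)) (σ x) := by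
  have h : norlundSeries (fun j => σ (a j)) (σ x) = PowerSeries.map σ (norlundSeries a x) := by
    rw [norlundSeries_eq, norlundSeries_eq, map_mul, map_prod]
    congr 1
    · ext n
      simp [coeff_egf]
    · exact Finset.prod_congr rfl fun j _ => (map_bernoulliFactor σ (a j)).symm
  simp [norlundPoly, h]

end ExponentialGeneratingFunctions

/-! ### Series in complete ultrametric groups. -/

section Ultrametric

variable {E : Type*} [NormedAddCommGroup E] [IsUltrametricDist E] [CompleteSpace E]

theorem summable_of_norm_le_of_tendsto {f : ℕ → E} {M : ℕ → ℝ} (hM : Tendsto M atTop (𝓝 0))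
    (hf : ∀ n, ‖f n‖ ≤ M n) : Summable f := by
  refine NonarchimedeanAddGroup.summable_of_tendsto_cofinite_zero ?_
  rw [Nat.cofinite_eq_atTop]
  exact squeeze_zero_norm hf hM

/-- Ultrametric dominated convergence for series. -/
theorem tendsto_tsum_of_norm_le_of_tendsto {F : ℕ → ℕ → E} {v : ℕ → E} {M : ℕ → ℝ}
    (hM : Tendsto M atTop (𝓝 0)) (hF : ∀ N n, ‖F N n‖ ≤ M n)
    (hv : ∀ n, Tendsto (fun N => F N n) atTop (𝓝 (v n))) :
    Tendsto (fun N => ∑' n, F N n) atTop (𝓝 (∑' n, v n)) := by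
  have hvM : ∀ n, ‖v n‖ ≤ M n := fun n =>
    le_of_tendsto (hv n).norm (Eventually.of_forall fun N => hF N n)
  have hvs : Summable v := summable_of_norm_le_of_tendsto hM hvM
  have hFs : ∀ N, Summable (F N) := fun N => summable_of_norm_le_of_tendsto hM (hF N)
  rw [Metric.tendsto_atTop]
  intro ε hε
  obtain ⟨n₀, hn₀⟩ := Metric.tendsto_atTop.1 hM (ε / 2) (half_pos hε)
  have hfin : Tendsto (fun N => ∑ n ∈ Finset.range n₀, F N n) atTop
      (𝓝 (∑ n ∈ Finset.range n₀, v n)) := tendsto_finsetSum _ fun n _ => hv n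
  obtain ⟨N₀, hN₀⟩ := Metric.tendsto_atTop.1 hfin (ε / 2) (half_pos hε)
  refine ⟨N₀, fun N hN => ?_⟩
  -- The norm of an ultrametric sum is at most a common bound of its terms, so `M → 0` controls the
  -- tails without `M` being summable.
  have htail : ∀ u : ℕ → E, (∀ n, ‖u n‖ ≤ M n) → ‖∑' n, u (n + n₀)‖ ≤ ε / 2 := by
    intro u hu
    refine IsUltrametricDist.norm_tsum_le_of_forall_le_of_nonneg (half_pos hε).le fun n => ?_
    have := hn₀ (n + n₀) (Nat.le_add_left _ _)
    rw [Real.dist_0_eq_abs] at this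
    exact (hu _).trans ((le_abs_self _).trans this.le)
  rw [← (hFs N).sum_add_tsum_nat_add n₀, ← hvs.sum_add_tsum_nat_add n₀, dist_eq_norm,
    add_sub_add_comm]
  refine (IsUltrametricDist.norm_add_le_max _ _).trans_lt (max_lt ?_ ?_)
  · rw [← dist_eq_norm]
    exact (hN₀ N hN).trans (half_lt_self hε)
  · rw [sub_eq_add_neg]
    refine (IsUltrametricDist.norm_add_le_max _ _).trans_lt (max_lt ?_ ?_)
    · exact (htail _ (hF N)).trans_lt (half_lt_self hε)
    · rw [norm_neg]
      exact (htail _ hvM).trans_lt (half_lt_self hε)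

end Ultrametric

theorem sum_range_mul_eq_sum_sum {M : Type*} [AddCommMonoid M] (f : ℕ → M) (a b : ℕ) :
    ∑ y ∈ Finset.range (a * b), f y =
      ∑ i ∈ Finset.range b, ∑ y ∈ Finset.range a, f (a * i + y) := by
  induction b with
  | zero => simp
  | succ b ih => rw [mul_add_one, Finset.sum_range_add, ih, Finset.sum_range_succ]

/-! ### Volkenborn integrals of powers, Nörlund polynomials and power series. -/

section Volkenborn

variable (p : ℕ) [Fact p.Prime]

theorem norm_padicIntToComplex_le_one (y : ℤ_[p]) : ‖padicIntToComplex p y‖ ≤ 1 := by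
  have h : ‖padicIntToComplex p y‖ = ‖(y : ℚ_[p])‖ := PadicComplex.norm_extends' p y
  rw [h]
  exact y.norm_le_one

theorem norm_prime_padicComplex : ‖(p : PadicComplex p)‖ = (p : ℝ)⁻¹ := by
  have h := PadicComplex.norm_extends' p (p : ℚ_[p])
  rw [Padic.norm_p] at h
  rw [← h]
  simp

theorem norm_intCast_padicComplex_le_one (z : ℤ) : ‖(z : PadicComplex p)‖ ≤ 1 := by
  have := norm_padicIntToComplex_le_one p (z : ℤ_[p])
  rwa [map_intCast] at this

/-- The Riemann sums `p^{-N} ∑_{y < p^N} y^m` of the Volkenborn integral of `y ↦ y^m`. -/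
noncomputable def volkenbornPowSum (N m : ℕ) : PadicComplex p :=
  ((p : PadicComplex p) ^ N)⁻¹ * ∑ y ∈ Finset.range (p ^ N), (y : PadicComplex p) ^ m

theorem prime_padicComplex_ne_zero : (p : PadicComplex p) ≠ 0 := by
  exact_mod_cast (Fact.out : p.Prime).ne_zero

/-- Writing the index as `p^N i + y`, each power is congruent to `y^m` modulo `p^N`. The difference
of the Riemann sums is therefore `q / p` with `q` an integer. -/
theorem norm_volkenbornPowSum_succ_sub_le (N m : ℕ) :
    ‖volkenbornPowSum p (N + 1) m - volkenbornPowSum p N m‖ ≤ p := by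
  have hp := prime_padicComplex_ne_zero p
  have hp0 : (0 : ℝ) < p := by exact_mod_cast (Fact.out : p.Prime).pos
  obtain ⟨q, hq⟩ : ∃ q : ℤ, ∑ y ∈ Finset.range (p ^ (N + 1)), (y : ℤ) ^ m -
      p * ∑ y ∈ Finset.range (p ^ N), (y : ℤ) ^ m = p ^ N * q := by
    have h : ∑ y ∈ Finset.range (p ^ (N + 1)), (y : ℤ) ^ m =
        ∑ i ∈ Finset.range p, ∑ y ∈ Finset.range (p ^ N), ((p ^ N * i + y : ℕ) : ℤ) ^ m := by
      rw [pow_succ, sum_range_mul_eq_sum_sum]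
    have h' : (p : ℤ) * ∑ y ∈ Finset.range (p ^ N), (y : ℤ) ^ m =
        ∑ i ∈ Finset.range p, ∑ y ∈ Finset.range (p ^ N), (y : ℤ) ^ m := by simp
    rw [h, h', ← Finset.sum_sub_distrib]
    refine Finset.dvd_sum fun i _ => ?_
    rw [← Finset.sum_sub_distrib]
    refine Finset.dvd_sum fun y _ => ?_
    refine dvd_trans ?_ (sub_dvd_pow_sub_pow _ _ m)
    push_cast
    exact ⟨i, by ring⟩
  have hq' := congrArg (Int.cast : ℤ → PadicComplex p) hq
  push_cast at hq'
  have : volkenbornPowSum p (N + 1) m - volkenbornPowSum p N m = (p : PadicComplex p)⁻¹ * q := by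
    rw [volkenbornPowSum, volkenbornPowSum, eq_inv_mul_iff_mul_eq₀ hp]
    have h2 : (q : PadicComplex p) = ((p : PadicComplex p) ^ N)⁻¹ * (p ^ N * q) := by
      rw [inv_mul_cancel_left₀ (pow_ne_zero N hp)]
    rw [h2, ← hq', pow_succ]
    field_simp
  rw [this, norm_mul, norm_inv, norm_prime_padicComplex, inv_inv]
  exact mul_le_of_le_one_right hp0.le (norm_intCast_padicComplex_le_one p q)

/-- By the ultrametric inequality the steps in `N` do not accumulate, so the bound is uniform in `N`
and `m`. -/
theorem norm_volkenbornPowSum_le (N m : ℕ) : ‖volkenbornPowSum p N m‖ ≤ p := by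
  have hp1 : (1 : ℝ) ≤ p := by exact_mod_cast (Fact.out : p.Prime).one_le
  induction N with
  | zero =>
    refine le_trans ?_ hp1
    simp only [volkenbornPowSum, pow_zero, inv_one, one_mul, Finset.range_one,
      Finset.sum_singleton, Nat.cast_zero]
    rcases eq_or_ne m 0 with rfl | hm <;> simp [*]
  | succ N ih =>
    have := IsUltrametricDist.norm_add_le_max
      (volkenbornPowSum p (N + 1) m - volkenbornPowSum p N m) (volkenbornPowSum p N m)
    rw [sub_add_cancel] at this
    exact this.trans (max_le (norm_volkenbornPowSum_succ_sub_le p N m) ih)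

theorem tendsto_volkenbornPowSum (m : ℕ) :
    Tendsto (fun N => volkenbornPowSum p N m) atTop (𝓝 (bernoulli m : PadicComplex p)) := by
  have hp := prime_padicComplex_ne_zero p
  have hp1 : (1 : ℝ) < p := by exact_mod_cast (Fact.out : p.Prime).one_lt
  have hpow : Tendsto (fun N => (p : PadicComplex p) ^ N) atTop (𝓝 0) := by
    refine tendsto_pow_atTop_nhds_zero_of_norm_lt_one ?_
    rw [norm_prime_padicComplex]
    exact inv_lt_one_of_one_lt₀ hp1
  have hm : (m : PadicComplex p) + 1 ≠ 0 := by exact_mod_cast m.succ_ne_zero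
  have h : ∀ N, volkenbornPowSum p N m = ∑ i ∈ Finset.range (m + 1),
      (bernoulli i : PadicComplex p) * ((m + 1).choose i : PadicComplex p) *
        ((p : PadicComplex p) ^ N) ^ (m - i) / (m + 1) := by
    intro N
    have h := congrArg (Rat.cast : ℚ → PadicComplex p) (sum_range_pow (p ^ N) m)
    push_cast at h
    rw [volkenbornPowSum, h, Finset.mul_sum]
    refine Finset.sum_congr rfl fun i hi => ?_
    -- Dividing by `p^N` lowers the Faulhaber exponent `m + 1 - i` to `m - i`, so in the limit only
    -- `i = m` survives.
    have hi' : m + 1 - i = (m - i) + 1 := by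
      have := Finset.mem_range.1 hi
      omega
    rw [hi', pow_succ _ (m - i)]
    have := pow_ne_zero N hp
    field_simp
  simp_rw [h]
  have key : (bernoulli m : PadicComplex p) = ∑ i ∈ Finset.range (m + 1),
      (bernoulli i : PadicComplex p) * ((m + 1).choose i : PadicComplex p) *
        (0 : PadicComplex p) ^ (m - i) / (m + 1) := by
    rw [Finset.sum_range_succ, Finset.sum_eq_zero]
    · simp [mul_div_assoc, div_self hm]
    · intro i hi
      have : m - i ≠ 0 := by
        have := Finset.mem_range.1 hi
        omega
      simp [this]
  rw [key]
  refine tendsto_finsetSum _ fun i _ => ?_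
  exact ((hpow.pow _).const_mul _).div_const _

theorem riemannSum_norlundPoly (N n k : ℕ) (w : PadicComplex p) :
    ((p : PadicComplex p) ^ N)⁻¹ * ∑ y ∈ Finset.range (p ^ N),
        norlundPoly n (fun _ : Fin k => (1 : PadicComplex p)) (w + padicIntToComplex p y) =
      ∑ ij ∈ Finset.HasAntidiagonal.antidiagonal n, (n.choose ij.1 : PadicComplex p) *
        norlundPoly ij.1 (fun _ : Fin k => (1 : PadicComplex p)) w *
          volkenbornPowSum p N ij.2 := by
  simp_rw [norlundPoly_add, map_natCast, volkenbornPowSum]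
  rw [Finset.sum_comm, Finset.mul_sum]
  refine Finset.sum_congr rfl fun ij _ => ?_
  rw [← Finset.mul_sum]
  ring

/-- The Volkenborn integral raises the order of the Bernoulli polynomials. -/
theorem hasVolkenbornIntegral_norlundPoly (n k : ℕ) (w : PadicComplex p) :
    HasVolkenbornIntegral p
      (fun y => norlundPoly n (fun _ : Fin k => (1 : PadicComplex p))
        (w + padicIntToComplex p y))
      (norlundPoly n (fun _ : Fin (k + 1) => (1 : PadicComplex p)) w) := by
  rw [HasVolkenbornIntegral, norlundPoly_succ_one]
  simp_rw [riemannSum_norlundPoly]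
  exact tendsto_finsetSum _ fun ij _ => (tendsto_volkenbornPowSum p ij.2).const_mul _

theorem norm_riemannSum_norlundPoly_le {n k : ℕ} {R : ℝ} (hR : 1 ≤ R) {w : PadicComplex p}
    (h : ∀ i, ‖norlundPoly i (fun _ : Fin k => (1 : PadicComplex p)) w‖ ≤ p ^ k * R ^ i)
    (N : ℕ) :
    ‖((p : PadicComplex p) ^ N)⁻¹ * ∑ y ∈ Finset.range (p ^ N),
        norlundPoly n (fun _ : Fin k => (1 : PadicComplex p)) (w + padicIntToComplex p y)‖ ≤
      p ^ (k + 1) * R ^ n := by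
  have hp0 : (0 : ℝ) ≤ p := Nat.cast_nonneg p
  rw [riemannSum_norlundPoly]
  refine IsUltrametricDist.norm_sum_le_of_forall_le_of_nonneg (by positivity) fun ij hij => ?_
  have hle : ij.1 ≤ n := by
    have := Finset.HasAntidiagonal.mem_antidiagonal.1 hij
    omega
  rw [norm_mul, norm_mul]
  calc _ ≤ 1 * ((p : ℝ) ^ k * R ^ n) * p := by
        gcongr
        · exact IsUltrametricDist.norm_natCast_le_one _ _
        · exact (h _).trans (by gcongr)
        · exact norm_volkenbornPowSum_le p N _
    _ = _ := by ring

/-- Order `k + 1` is a limit of Riemann sums of order `k`, and each integration costs one factor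
`p`. -/
theorem norm_norlundPoly_one_le {R : ℝ} (hR : 1 ≤ R) (k : ℕ) {w : PadicComplex p} (hw : ‖w‖ ≤ R)
    (n : ℕ) : ‖norlundPoly n (fun _ : Fin k => (1 : PadicComplex p)) w‖ ≤ p ^ k * R ^ n := by
  induction k generalizing n with
  | zero =>
    rw [norlundPoly_fin_zero, norm_pow, pow_zero, one_mul]
    gcongr
  | succ k ih =>
    exact le_of_tendsto (hasVolkenbornIntegral_norlundPoly p n k w).norm
      (Eventually.of_forall (norm_riemannSum_norlundPoly_le p hR ih))

theorem summable_mul_norlundPoly_one {R : ℝ} (hR : 1 ≤ R) {c : ℕ → PadicComplex p}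
    (hc : Tendsto (fun n => ‖c n‖ * R ^ n) atTop (𝓝 0)) (k : ℕ) {w : PadicComplex p}
    (hw : ‖w‖ ≤ R) :
    Summable fun n => c n * norlundPoly n (fun _ : Fin k => (1 : PadicComplex p)) w := by
  have hM := hc.const_mul ((p : ℝ) ^ k)
  rw [mul_zero] at hM
  refine summable_of_norm_le_of_tendsto hM fun n => ?_
  rw [norm_mul, mul_left_comm]
  gcongr
  exact norm_norlundPoly_one_le p hR k hw n

theorem norm_add_padicIntToComplex_le {R : ℝ} (hR : 1 ≤ R) {w : PadicComplex p} (hw : ‖w‖ ≤ R)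
    (y : ℤ_[p]) : ‖w + padicIntToComplex p y‖ ≤ R :=
  (IsUltrametricDist.norm_add_le_max _ _).trans
    (max_le hw ((norm_padicIntToComplex_le_one p y).trans hR))

theorem hasVolkenbornIntegral_tsum_norlundPoly {R : ℝ} (hR : 1 ≤ R) {c : ℕ → PadicComplex p}
    (hc : Tendsto (fun n => ‖c n‖ * R ^ n) atTop (𝓝 0)) (k : ℕ) {w : PadicComplex p}
    (hw : ‖w‖ ≤ R) :
    HasVolkenbornIntegral p
      (fun y => ∑' n, c n * norlundPoly n (fun _ : Fin k => (1 : PadicComplex p))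
        (w + padicIntToComplex p y))
      (∑' n, c n * norlundPoly n (fun _ : Fin (k + 1) => (1 : PadicComplex p)) w) := by
  have hM := hc.const_mul ((p : ℝ) ^ (k + 1))
  rw [mul_zero] at hM
  have hN : ∀ N : ℕ, ((p : PadicComplex p) ^ N)⁻¹ * ∑ y ∈ Finset.range (p ^ N),
      ∑' n, c n * norlundPoly n (fun _ : Fin k => (1 : PadicComplex p))
        (w + padicIntToComplex p y) =
      ∑' n, c n * (((p : PadicComplex p) ^ N)⁻¹ * ∑ y ∈ Finset.range (p ^ N),
        norlundPoly n (fun _ : Fin k => (1 : PadicComplex p)) (w + padicIntToComplex p y)) := by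
    intro N
    rw [← Summable.tsum_finsetSum fun y _ =>
      summable_mul_norlundPoly_one p hR hc k (norm_add_padicIntToComplex_le p hR hw _), ← tsum_mul_left]
    refine tsum_congr fun n => ?_
    rw [← Finset.mul_sum]
    ring
  rw [HasVolkenbornIntegral]
  simp_rw [hN]
  refine tendsto_tsum_of_norm_le_of_tendsto hM (fun N n => ?_) fun n =>
    (hasVolkenbornIntegral_norlundPoly p n k w).const_mul _
  rw [norm_mul, mul_left_comm]
  gcongr
  exact norm_riemannSum_norlundPoly_le p hR (norm_norlundPoly_one_le p hR k hw) N

/-- The multivariate Volkenborn integral of `y ↦ ∑ₙ cₙ (w + |y|)ⁿ`. -/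
theorem hasMultiVolkenbornIntegral_tsum {R : ℝ} (hR : 1 ≤ R) {c : ℕ → PadicComplex p}
    (hc : Tendsto (fun n => ‖c n‖ * R ^ n) atTop (𝓝 0)) (k : ℕ) {w : PadicComplex p}
    (hw : ‖w‖ ≤ R) :
    HasMultiVolkenbornIntegral p k
      (fun y => ∑' n, c n * (w + ∑ j, padicIntToComplex p (y j)) ^ n)
      (∑' n, c n * norlundPoly n (fun _ : Fin k => (1 : PadicComplex p)) w) := by
  induction k generalizing w with
  | zero => simp [HasMultiVolkenbornIntegral, norlundPoly_fin_zero]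
  | succ k ih =>
    -- The outer variable is absorbed into `w`; the ball of radius `R ≥ 1` is stable under
    -- translation by `ℤ_p`.
    refine ⟨_, fun y => ?_, hasVolkenbornIntegral_tsum_norlundPoly p hR hc k hw⟩
    simp_rw [Fin.sum_univ_succ, Fin.cons_zero, Fin.cons_succ, ← add_assoc]
    exact ih (norm_add_padicIntToComplex_le p hR hw y)

end Volkenborn

/-! ### Laplace transform of the logistic law. -/

section Logistic

theorem logistic_density_eq (x : ℝ) :
    Real.pi / 2 * (1 / Real.cosh (Real.pi * x)) ^ 2 =
      |Real.sigmoid (2 * Real.pi * x) * (1 - Real.sigmoid (2 * Real.pi * x)) * (2 * Real.pi)| := by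
  have h0 := Real.sigmoid_pos (2 * Real.pi * x)
  have h1 := Real.sigmoid_lt_one (2 * Real.pi * x)
  rw [abs_of_nonneg (mul_nonneg (mul_nonneg h0.le (sub_nonneg.2 h1.le)) Real.two_pi_pos.le),
    Real.sigmoid_def, Real.cosh_eq, show -(2 * Real.pi * x) = -(Real.pi * x) + -(Real.pi * x) by ring,
    Real.exp_add, Real.exp_neg]
  have := Real.exp_pos (Real.pi * x)
  field_simp
  ring

theorem hasDerivAt_sigmoid_two_pi_mul (x : ℝ) :
    HasDerivAt (fun x => Real.sigmoid (2 * Real.pi * x))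
      (Real.sigmoid (2 * Real.pi * x) * (1 - Real.sigmoid (2 * Real.pi * x)) * (2 * Real.pi)) x := by
  have h : HasDerivAt (fun x : ℝ => 2 * Real.pi * x) (2 * Real.pi) x := by
    simpa using (hasDerivAt_id x).const_mul (2 * Real.pi)
  exact (Real.hasDerivAt_sigmoid _).comp x h

theorem sigmoid_two_pi_mul_injOn :
    Set.InjOn (fun x => Real.sigmoid (2 * Real.pi * x)) Set.univ := by
  intro x _ y _ h
  exact mul_left_cancel₀ Real.two_pi_pos.ne' (Real.sigmoid_injective h)

theorem image_sigmoid_two_pi_mul :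
    (fun x => Real.sigmoid (2 * Real.pi * x)) '' Set.univ = Set.Ioo 0 1 := by
  rw [Set.image_univ, ← Real.range_sigmoid]
  exact (mul_left_surjective₀ Real.two_pi_pos.ne').range_comp Real.sigmoid

variable {E : Type*} [NormedAddCommGroup E] [NormedSpace ℝ E]

theorem measurable_logistic_density : Measurable fun x : ℝ =>
    ENNReal.ofReal (Real.pi / 2 * (1 / Real.cosh (Real.pi * x)) ^ 2) := by
  have : Measurable Real.cosh := Real.continuous_cosh.measurable
  fun_prop

theorem toReal_logistic_density (x : ℝ) :
    (ENNReal.ofReal (Real.pi / 2 * (1 / Real.cosh (Real.pi * x)) ^ 2)).toReal =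
      |Real.sigmoid (2 * Real.pi * x) * (1 - Real.sigmoid (2 * Real.pi * x)) * (2 * Real.pi)| := by
  rw [ENNReal.toReal_ofReal (by positivity), logistic_density_eq]

/-- The logistic distribution is the law of `logit U / (2 π)` with `U` uniform on `(0, 1)`. -/
theorem integral_logisticMeasure_comp_sigmoid (g : ℝ → E) :
    ∫ x, g (Real.sigmoid (2 * Real.pi * x)) ∂logisticMeasure = ∫ v in Set.Ioo 0 1, g v := by
  rw [← image_sigmoid_two_pi_mul, integral_image_eq_integral_abs_deriv_smul MeasurableSet.univ
    (fun x _ => (hasDerivAt_sigmoid_two_pi_mul x).hasDerivWithinAt) sigmoid_two_pi_mul_injOn,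
    logisticMeasure, integral_withDensity_eq_integral_toReal_smul measurable_logistic_density
    (ae_of_all _ fun _ => ENNReal.ofReal_lt_top), setIntegral_univ]
  simp_rw [toReal_logistic_density]

theorem integrable_logisticMeasure_comp_sigmoid_iff (g : ℝ → E) :
    Integrable (fun x => g (Real.sigmoid (2 * Real.pi * x))) logisticMeasure ↔
      IntegrableOn g (Set.Ioo 0 1) := by
  rw [← image_sigmoid_two_pi_mul, integrableOn_image_iff_integrableOn_abs_deriv_smul
    MeasurableSet.univ (fun x _ => (hasDerivAt_sigmoid_two_pi_mul x).hasDerivWithinAt)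
    sigmoid_two_pi_mul_injOn, logisticMeasure,
    integrable_withDensity_iff_integrable_smul' measurable_logistic_density
    (ae_of_all _ fun _ => ENNReal.ofReal_lt_top), integrableOn_univ]
  simp_rw [toReal_logistic_density]

/-- For `v = sigmoid y` one has `v / (1 - v) = e^y`. The exponents stay unsimplified to match the
Beta integrand. -/
theorem sigmoid_cpow_mul_cpow (z : ℂ) (y : ℝ) :
    (Real.sigmoid y : ℂ) ^ (1 + z - 1) * (1 - (Real.sigmoid y : ℂ)) ^ (1 - z - 1) =
      Complex.exp (z * y) := by
  have h0 := Real.sigmoid_pos y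
  have h1 := Real.sigmoid_pos (-y)
  have h : Real.log (Real.sigmoid (-y)) = Real.log (Real.sigmoid y) - y := by
    rw [← Real.sigmoid_mul_rexp_neg, Real.log_mul h0.ne' (Real.exp_pos _).ne', Real.log_exp]
    ring
  have h2 : (1 - (Real.sigmoid y : ℂ)) = (Real.sigmoid (-y) : ℂ) := by
    rw [Real.sigmoid_neg]
    push_cast
    rfl
  rw [h2, Complex.cpow_def_of_ne_zero (by exact_mod_cast h0.ne'),
    Complex.cpow_def_of_ne_zero (by exact_mod_cast h1.ne'), ← Complex.exp_add,
    ← Complex.ofReal_log h0.le, ← Complex.ofReal_log h1.le, h]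
  congr 1
  push_cast
  ring

theorem integrable_cexp_logisticMeasure {s : ℂ} (hs : |s.re| < 2 * Real.pi) :
    Integrable (fun x : ℝ => Complex.exp (s * x)) logisticMeasure := by
  have hπ := Real.two_pi_pos
  obtain ⟨h1, h2⟩ := abs_lt.1 hs
  have hre : (s / (2 * Real.pi : ℝ)).re = s.re / (2 * Real.pi) := Complex.div_ofReal_re _ _
  have hu : 0 < (1 + s / (2 * Real.pi : ℝ)).re := by
    rw [Complex.add_re, hre, Complex.one_re]
    have : -1 < s.re / (2 * Real.pi) := by rw [lt_div_iff₀ hπ]; linarith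
    linarith
  have hv : 0 < (1 - s / (2 * Real.pi : ℝ)).re := by
    rw [Complex.sub_re, hre, Complex.one_re]
    have : s.re / (2 * Real.pi) < 1 := by rw [div_lt_iff₀ hπ]; linarith
    linarith
  have h := Complex.betaIntegral_convergent hu hv
  rw [intervalIntegrable_iff_integrableOn_Ioo_of_le zero_le_one,
    ← integrable_logisticMeasure_comp_sigmoid_iff] at h
  refine h.congr (ae_of_all _ fun x => ?_)
  simp only
  rw [sigmoid_cpow_mul_cpow]
  congr 1
  have : (Real.pi : ℂ) ≠ 0 := by exact_mod_cast Real.pi_ne_zero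
  push_cast
  field_simp

/-- With `z = s / (2π)` the integral is `Γ(1+z) Γ(1-z) / Γ(2)`, evaluated by the reflection formula.
The product form includes `s = 0`. -/
theorem integral_cexp_logisticMeasure {s : ℂ} (hs : |s.re| < 2 * Real.pi) :
    (∫ x : ℝ, Complex.exp (s * x) ∂logisticMeasure) * Complex.sin (s / 2) = s / 2 := by
  have hπ := Real.two_pi_pos
  have hπ' : (Real.pi : ℂ) ≠ 0 := by exact_mod_cast Real.pi_ne_zero
  rcases eq_or_ne s 0 with rfl | hs0
  · simp
  obtain ⟨h1, h2⟩ := abs_lt.1 hs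
  set z : ℂ := s / (2 * Real.pi : ℝ) with hz
  have hre : z.re = s.re / (2 * Real.pi) := Complex.div_ofReal_re _ _
  have hz0 : z ≠ 0 := div_ne_zero hs0 (by exact_mod_cast hπ.ne')
  have hl : -1 < z.re := by rw [hre, lt_div_iff₀ hπ]; linarith
  have hr : z.re < 1 := by rw [hre, div_lt_iff₀ hπ]; linarith
  have hu : 0 < (1 + z).re := by
    rw [Complex.add_re, Complex.one_re]
    linarith
  have hv : 0 < (1 - z).re := by
    rw [Complex.sub_re, Complex.one_re]
    linarith
  have h := Complex.Gamma_mul_Gamma_eq_betaIntegral hu hv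
  have hsin : Complex.sin (Real.pi * z) ≠ 0 := by
    rw [Complex.sin_ne_zero_iff]
    intro k hk
    rw [mul_comm] at hk
    have hk' : z = (k : ℂ) := mul_right_cancel₀ hπ' hk
    rw [hk', Complex.intCast_re] at hl hr
    have hk0 : k = 0 := by
      have a : (-1 : ℤ) < k := by exact_mod_cast hl
      have b : k < (1 : ℤ) := by exact_mod_cast hr
      omega
    exact hz0 (by rw [hk', hk0, Int.cast_zero])
  rw [add_comm 1 z, Complex.Gamma_add_one z hz0, mul_assoc, Complex.Gamma_mul_Gamma_one_sub,
    show z + 1 + (1 - z) = 1 + 1 by ring, Complex.Gamma_add_one 1 one_ne_zero, Complex.Gamma_one,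
    one_mul, one_mul, add_comm z 1, Complex.betaIntegral, intervalIntegral.integral_of_le
    zero_le_one, integral_Ioc_eq_integral_Ioo, ← integral_logisticMeasure_comp_sigmoid] at h
  have h' : (∫ x : ℝ, Complex.exp (s * x) ∂logisticMeasure) =
      z * (Real.pi / Complex.sin (Real.pi * z)) := by
    rw [h]
    refine integral_congr_ae (ae_of_all _ fun x => ?_)
    simp only
    rw [sigmoid_cpow_mul_cpow, hz]
    congr 1
    push_cast
    field_simp
  have h2 : s / 2 = Real.pi * z := by
    rw [hz]
    push_cast
    field_simp
  rw [h', h2, mul_assoc, div_mul_cancel₀ _ hsin, mul_comm]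

/-- This is the case `s = it`; the shift by `-1/2` supplies the `e^{-t/2}` in `e^t - 1 = 2 e^{t/2}
sinh (t/2)`. -/
theorem integral_cexp_shifted_logisticMeasure {t : ℂ} (ht : |t.im| < 2 * Real.pi) :
    (∫ x : ℝ, Complex.exp (t * (Complex.I * x - 1 / 2)) ∂logisticMeasure) *
      (Complex.exp t - 1) = t := by
  have hs : |(t * Complex.I).re| < 2 * Real.pi := by simpa using ht
  have h := integral_cexp_logisticMeasure hs
  have he : ∀ x : ℝ, Complex.exp (t * (Complex.I * x - 1 / 2)) =
      Complex.exp (-(t / 2)) * Complex.exp (t * Complex.I * x) := by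
    intro x
    rw [← Complex.exp_add]
    congr 1
    ring
  simp_rw [he]
  rw [integral_const_mul]
  have h3 : Complex.exp t - 1 =
      Complex.exp (t / 2) * (-2 * Complex.I * Complex.sin (t * Complex.I / 2)) := by
    rw [show t * Complex.I / 2 = (t / 2) * Complex.I by ring, Complex.sin_mul_I, Complex.sinh]
    have : Complex.exp t = Complex.exp (t / 2) * Complex.exp (t / 2) := by
      rw [← Complex.exp_add]
      congr 1
      ring
    have h4 : Complex.exp (t / 2) * Complex.exp (-(t / 2)) = 1 := by
      rw [← Complex.exp_add]
      simp
    linear_combination this + h4 +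
      (Complex.exp (t / 2) * Complex.exp (t / 2) - Complex.exp (t / 2) * Complex.exp (-(t / 2))) *
        (Complex.I_mul_I)
  have h4 : Complex.exp (t / 2) * Complex.exp (-(t / 2)) = 1 := by
    rw [← Complex.exp_add]
    simp
  rw [h3]
  set J := ∫ x : ℝ, Complex.exp (t * Complex.I * x) ∂logisticMeasure
  set S := Complex.sin (t * Complex.I / 2)
  linear_combination (-2 * Complex.I * J * S) * h4 + (-2 * Complex.I) * h - t * Complex.I_mul_I

theorem integrable_exp_mul_abs_logisticMeasure {A : ℝ} (hA : |A| < 2 * Real.pi) :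
    Integrable (fun x : ℝ => Real.exp (A * |x|)) logisticMeasure := by
  have key : ∀ B : ℝ, |B| < 2 * Real.pi →
      Integrable (fun x : ℝ => Real.exp (B * x)) logisticMeasure := by
    intro B hB
    have h := (integrable_cexp_logisticMeasure (s := B) (by simpa using hB)).norm
    refine h.congr (ae_of_all _ fun x => ?_)
    simp [Complex.norm_exp]
  exact integrable_exp_mul_abs (key A hA) (key (-A) (by rwa [abs_neg]))

end Logistic

/-! ### Moment series of complex random variables. -/

section MomentSeries

variable {Ω : Type*} [MeasurableSpace Ω] {P : Measure Ω}

/-- Term-by-term integration of `∑ₙ cₙ Zⁿ` for `Z` with an exponential moment of order `A`. -/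
theorem hasSum_integral_pow_of_integrable_exp {Z : Ω → ℂ} (hZ : AEStronglyMeasurable Z P)
    {A C : ℝ} (hint : Integrable (fun ω => Real.exp (A * ‖Z ω‖)) P) {c : ℕ → ℂ}
    (hc : ∀ n, (n ! : ℝ) * ‖c n‖ ≤ C * A ^ n) :
    Integrable (fun ω => ∑' n, c n * Z ω ^ n) P ∧
      HasSum (fun n => c n * ∫ ω, Z ω ^ n ∂P) (∫ ω, ∑' n, c n * Z ω ^ n ∂P) := by
  set bound : ℕ → Ω → ℝ := fun n ω => C * ((A * ‖Z ω‖) ^ n / n !) with hbound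
  have hsum : ∀ ω, HasSum (fun n => bound n ω) (C * Real.exp (A * ‖Z ω‖)) := by
    intro ω
    rw [Real.exp_eq_exp_ℝ]
    exact (NormedSpace.expSeries_div_hasSum_exp (A * ‖Z ω‖)).mul_left C
  have hle : ∀ n ω, ‖c n * Z ω ^ n‖ ≤ bound n ω := by
    intro n ω
    have hn : (0 : ℝ) < n ! := by exact_mod_cast n.factorial_pos
    rw [norm_mul, norm_pow, hbound]
    simp only
    rw [mul_pow, ← mul_div_assoc, le_div_iff₀ hn]
    calc ‖c n‖ * ‖Z ω‖ ^ n * n ! = (n ! * ‖c n‖) * ‖Z ω‖ ^ n := by ring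
      _ ≤ C * A ^ n * ‖Z ω‖ ^ n := mul_le_mul_of_nonneg_right (hc n) (by positivity)
      _ = _ := by ring
  have hmeas : ∀ n, AEStronglyMeasurable (fun ω => c n * Z ω ^ n) P := fun n =>
    (hZ.pow n).const_mul _
  have hZsum : ∀ ω, HasSum (fun n => c n * Z ω ^ n) (∑' n, c n * Z ω ^ n) := fun ω =>
    (Summable.of_norm_bounded (hsum ω).summable fun n => hle n ω).hasSum
  have hb : Integrable (fun ω => ∑' n, bound n ω) P := by
    simp_rw [fun ω => (hsum ω).tsum_eq]
    exact hint.const_mul C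
  constructor
  · refine hb.mono' ?_ (ae_of_all _ fun ω => ?_)
    · refine aestronglyMeasurable_of_tendsto_ae (u := atTop)
        (f := fun N ω => ∑ n ∈ Finset.range N, c n * Z ω ^ n) (fun N => ?_)
        (ae_of_all _ fun ω => (hZsum ω).tendsto_sum_nat)
      exact Finset.aestronglyMeasurable_fun_sum _ fun n _ => hmeas n
    · exact tsum_of_norm_bounded (hsum ω).summable.hasSum fun n => hle n ω
  · have := hasSum_integral_of_dominated_convergence bound hmeas
      (fun n => ae_of_all _ (hle n)) (ae_of_all _ fun ω => (hsum ω).summable) hb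
      (ae_of_all _ hZsum)
    simpa only [integral_const_mul] using this

/-- `Z` has moments of all orders, with exponential generating function `q`. -/
def HasMomentSeries (P : Measure Ω) (Z : Ω → ℂ) (q : ℂ⟦X⟧) : Prop :=
  (∀ n, Integrable (fun ω => Z ω ^ n) P) ∧ egf (fun n => ∫ ω, Z ω ^ n ∂P) = q

theorem HasMomentSeries.aestronglyMeasurable {Z : Ω → ℂ} {q : ℂ⟦X⟧} (h : HasMomentSeries P Z q) :
    AEStronglyMeasurable Z P := by
  simpa using (h.1 1).aestronglyMeasurable

theorem hasMomentSeries_const [IsProbabilityMeasure P] (x : ℂ) :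
    HasMomentSeries P (fun _ => x) (egf (x ^ ·)) :=
  ⟨fun n => integrable_const _, by simp⟩

/-- Independence factors the mixed moments in the binomial expansion, leaving the convolution of
`egf_mul`. -/
theorem HasMomentSeries.add {Z W : Ω → ℂ} {q r : ℂ⟦X⟧} (hZ : HasMomentSeries P Z q)
    (hW : HasMomentSeries P W r) (hind : IndepFun Z W P) :
    HasMomentSeries P (fun ω => Z ω + W ω) (q * r) := by
  have hpow : ∀ i j, IndepFun (fun ω => Z ω ^ i) (fun ω => W ω ^ j) P := fun i j =>
    hind.comp (by fun_prop : Measurable fun z : ℂ => z ^ i) (by fun_prop : Measurable fun z : ℂ => z ^ j)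
  have hint : ∀ n, ∀ ij ∈ Finset.HasAntidiagonal.antidiagonal n,
      Integrable (fun ω => (n.choose ij.1 : ℂ) * (Z ω ^ ij.1 * W ω ^ ij.2)) P := fun n ij _ =>
    ((hpow ij.1 ij.2).integrable_mul (hZ.1 _) (hW.1 _)).const_mul _
  have hexp : ∀ n, (fun ω => (Z ω + W ω) ^ n) = fun ω =>
      ∑ ij ∈ Finset.HasAntidiagonal.antidiagonal n,
        (n.choose ij.1 : ℂ) * (Z ω ^ ij.1 * W ω ^ ij.2) := by
    intro n
    ext ω
    rw [(Commute.all (Z ω) (W ω)).add_pow']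
    simp_rw [nsmul_eq_mul]
  refine ⟨fun n => ?_, ?_⟩
  · rw [hexp]
    exact integrable_finsetSum _ (hint n)
  · rw [← hZ.2, ← hW.2, egf_mul]
    congr 1
    ext n
    rw [hexp, integral_finsetSum _ (hint n)]
    refine Finset.sum_congr rfl fun ij _ => ?_
    rw [integral_const_mul, (hpow ij.1 ij.2).integral_fun_mul_eq_mul_integral
      (hZ.1 _).aestronglyMeasurable (hW.1 _).aestronglyMeasurable, mul_assoc]

theorem HasMomentSeries.const_mul {Z : Ω → ℂ} {q : ℂ⟦X⟧} (hZ : HasMomentSeries P Z q) (a : ℂ) :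
    HasMomentSeries P (fun ω => a * Z ω) (PowerSeries.rescale a q) := by
  refine ⟨fun n => ?_, ?_⟩
  · simp_rw [mul_pow]
    exact (hZ.1 n).const_mul _
  · rw [← hZ.2]
    ext n
    simp_rw [mul_pow, PowerSeries.coeff_rescale, coeff_egf, integral_const_mul, mul_div_assoc]

theorem hasMomentSeries_sum [IsProbabilityMeasure P] {ι : Type*} {Z : ι → Ω → ℂ} {q : ι → ℂ⟦X⟧}
    (hZ : ∀ i, HasMomentSeries P (Z i) (q i)) (hind : iIndepFun Z P) (s : Finset ι) :
    HasMomentSeries P (fun ω => ∑ i ∈ s, Z i ω) (∏ i ∈ s, q i) := by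
  classical
  induction s using Finset.induction_on with
  | empty =>
    have h : egf ((0 : ℂ) ^ ·) = 1 := by
      ext n
      rw [coeff_egf, PowerSeries.coeff_one]
      split_ifs with hn <;> simp [hn]
    simpa [h] using hasMomentSeries_const (P := P) 0
  | insert i s hi ih =>
    have h := hind.indepFun_finsetSum_of_notMem₀
      (fun j => (hZ j).aestronglyMeasurable.aemeasurable) hi
    have h' : IndepFun (Z i) (fun ω => ∑ j ∈ s, Z j ω) P := by
      convert! h.symm using 1
      ext ω
      simp
    simp_rw [Finset.sum_insert hi, Finset.prod_insert hi]
    exact (hZ i).add ih h'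

theorem integrable_exp_mul_sum_of_iIndepFun [IsProbabilityMeasure P] {ι : Type*} {X : ι → Ω → ℝ}
    (hX : ∀ i, AEMeasurable (X i) P) (hind : iIndepFun X P) {A : ℝ}
    (hint : ∀ i, Integrable (fun ω => Real.exp (A * X i ω)) P) (s : Finset ι) :
    Integrable (fun ω => Real.exp (A * ∑ i ∈ s, X i ω)) P := by
  classical
  induction s using Finset.induction_on with
  | empty => simp
  | insert i s hi ih =>
    have h := hind.indepFun_finsetSum_of_notMem₀ hX hi
    have h' := (h.comp (by fun_prop : Measurable fun x : ℝ => Real.exp (A * x))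
      (by fun_prop : Measurable fun x : ℝ => Real.exp (A * x))).symm.integrable_mul (hint i)
      (by simpa [Function.comp_def] using ih)
    refine h'.congr (ae_of_all _ fun ω => ?_)
    simp [Finset.sum_insert hi, mul_add, Real.exp_add]

theorem eq_zero_of_hasSum_zero {q : ℂ⟦X⟧}
    (h : ∀ᶠ t : ℂ in 𝓝 0, HasSum (fun n => q.coeff n * t ^ n) 0) : q = 0 := by
  have hp : HasFPowerSeriesAt (0 : ℂ → ℂ)
      (FormalMultilinearSeries.ofScalars ℂ fun n => q.coeff n) 0 := by
    rw [hasFPowerSeriesAt_iff]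
    filter_upwards [h] with t ht
    simpa [FormalMultilinearSeries.coeff_ofScalars, mul_comm] using ht
  have h0 := hp.eq_zero
  ext n
  have := FormalMultilinearSeries.coeff_ofScalars (𝕜 := ℂ) (p := fun n => q.coeff n) (n := n)
  rw [h0] at this
  simpa [FormalMultilinearSeries.coeff] using this.symm

theorem HasSum.powerSeries_mul {q r : ℂ⟦X⟧} {t a b : ℂ}
    (hq : HasSum (fun n => q.coeff n * t ^ n) a) (hr : HasSum (fun n => r.coeff n * t ^ n) b) :
    HasSum (fun n => (q * r).coeff n * t ^ n) (a * b) := by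
  have hs := summable_norm_sum_mul_antidiagonal_of_summable_norm hq.summable.norm hr.summable.norm
  have ht := tsum_mul_tsum_eq_tsum_sum_antidiagonal_of_summable_norm hq.summable.norm
    hr.summable.norm
  rw [hq.tsum_eq, hr.tsum_eq] at ht
  rw [ht]
  convert! hs.of_norm.hasSum using 2 with n
  rw [PowerSeries.coeff_mul, Finset.sum_mul]
  refine Finset.sum_congr rfl fun ij hij => ?_
  rw [← Finset.HasAntidiagonal.mem_antidiagonal.1 hij, pow_add]
  ring

end MomentSeries

/-! ### Moments of sums of shifted logistic variables. -/

section LogisticMoments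

theorem norm_I_mul_sub_half_le (x : ℝ) : ‖Complex.I * (x : ℂ) - 1 / 2‖ ≤ |x| + 1 / 2 := by
  refine (norm_sub_le _ _).trans (le_of_eq ?_)
  simp

theorem measurable_I_mul_sub_half : Measurable fun x : ℝ => Complex.I * (x : ℂ) - 1 / 2 := by
  fun_prop

theorem integrable_exp_mul_norm_shifted {A : ℝ} (hA0 : 0 ≤ A) (hA : A < 2 * Real.pi) :
    Integrable (fun x : ℝ => Real.exp (A * ‖Complex.I * (x : ℂ) - 1 / 2‖)) logisticMeasure := by
  have h := (integrable_exp_mul_abs_logisticMeasure (by rwa [abs_of_nonneg hA0])).mul_const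
    (Real.exp (A * (1 / 2)))
  refine h.mono' ?_ (ae_of_all _ fun x => ?_)
  · have := measurable_I_mul_sub_half
    exact (by fun_prop : Measurable _).aestronglyMeasurable
  · rw [Real.norm_of_nonneg (Real.exp_pos _).le, ← Real.exp_add, ← mul_add]
    gcongr
    exact norm_I_mul_sub_half_le x

theorem integrable_shifted_pow (n : ℕ) :
    Integrable (fun x : ℝ => (Complex.I * (x : ℂ) - 1 / 2) ^ n) logisticMeasure := by
  have h := (integrable_exp_mul_norm_shifted zero_le_one
    (by linarith [Real.pi_gt_three])).mul_const (n ! : ℝ)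
  refine h.mono' (measurable_I_mul_sub_half.pow_const n).aestronglyMeasurable
    (ae_of_all _ fun x => ?_)
  rw [norm_pow, one_mul]
  have hn : (0 : ℝ) < n ! := by exact_mod_cast n.factorial_pos
  rw [← div_le_iff₀ hn]
  exact Real.pow_div_factorial_le_exp _ (norm_nonneg _) n

theorem hasMomentSeries_logistic :
    HasMomentSeries logisticMeasure (fun x : ℝ => Complex.I * (x : ℂ) - 1 / 2)
      (bernoulliFactor 1) := by
  refine ⟨integrable_shifted_pow, ?_⟩
  set m : ℕ → ℂ := fun n => ∫ x : ℝ, (Complex.I * (x : ℂ) - 1 / 2) ^ n ∂logisticMeasure with hm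
  have hE : PowerSeries.mk (fun n => (1 : ℂ) ^ n / (n ! : ℂ)) - 1 ≠ 0 := by
    intro h
    have := congrArg (PowerSeries.coeff 1) h
    simp [PowerSeries.coeff_one] at this
  -- It remains to prove the formal identity `q (e^t - 1) = t`. This follows from the analytic one
  -- on the unit disc, inside `|Im t| < 2π`, by uniqueness of power series expansions.
  refine mul_right_cancel₀ hE ?_
  rw [bernoulliFactor_mul, map_one, one_mul, ← sub_eq_zero]
  refine eq_zero_of_hasSum_zero ?_
  filter_upwards [Metric.ball_mem_nhds (0 : ℂ) one_pos] with t ht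
  rw [mem_ball_zero_iff] at ht
  have hπ := Real.pi_gt_three
  have h1 : HasSum (fun n => (egf m).coeff n * t ^ n)
      (∫ x : ℝ, Complex.exp (t * (Complex.I * x - 1 / 2)) ∂logisticMeasure) := by
    have h := (hasSum_integral_pow_of_integrable_exp (P := logisticMeasure)
      (Z := fun x : ℝ => Complex.I * (x : ℂ) - 1 / 2) (c := fun n => t ^ n / (n ! : ℂ)) (C := 1)
      measurable_I_mul_sub_half.aestronglyMeasurable
      (integrable_exp_mul_norm_shifted (norm_nonneg t) (by linarith)) (fun n => ?_)).2
    · have hexp : ∀ x : ℝ, Complex.exp (t * (Complex.I * x - 1 / 2)) =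
          ∑' n, t ^ n / (n ! : ℂ) * (Complex.I * (x : ℂ) - 1 / 2) ^ n := by
        intro x
        rw [Complex.exp_eq_exp_ℂ, NormedSpace.exp_eq_tsum_div]
        refine tsum_congr fun n => ?_
        rw [mul_pow]
        ring
      simp_rw [hexp]
      convert! h using 2 with n
      rw [coeff_egf]
      ring
    · have hn : (0 : ℝ) < n ! := by exact_mod_cast n.factorial_pos
      rw [norm_div, norm_pow, Complex.norm_natCast, mul_div_cancel₀ _ hn.ne', one_mul]
  have h2 : HasSum (fun n => (PowerSeries.mk (fun n => (1 : ℂ) ^ n / (n ! : ℂ)) - 1).coeff n * t ^ n)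
      (Complex.exp t - 1) := by
    have ha : HasSum (fun n => t ^ n / (n ! : ℂ)) (Complex.exp t) := by
      rw [Complex.exp_eq_exp_ℂ]
      exact NormedSpace.expSeries_div_hasSum_exp t
    have hb := ha.sub (hasSum_ite_eq 0 (1 : ℂ))
    convert! hb using 2 with n
    rw [map_sub, PowerSeries.coeff_mk, PowerSeries.coeff_one]
    split_ifs with hn
    · simp [hn]
    · simp
      ring
  have h3 : HasSum (fun n => (PowerSeries.X : ℂ⟦X⟧).coeff n * t ^ n) t := by
    convert! hasSum_ite_eq 1 t using 2 with n
    rw [PowerSeries.coeff_X]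
    split_ifs with hn
    · simp [hn]
    · simp
  have h4 := (h1.powerSeries_mul h2).sub h3
  rw [integral_cexp_shifted_logisticMeasure
    ((Complex.abs_im_le_norm t).trans_lt (by linarith)), sub_self] at h4
  convert! h4 using 2 with n
  rw [map_sub, sub_mul]

theorem rescale_bernoulliFactor_one (a : ℂ) :
    PowerSeries.rescale a (bernoulliFactor 1) = bernoulliFactor a := by
  rw [eq_bernoulliFactor_iff]
  have h : expQuotient a = PowerSeries.rescale a (expQuotient 1) := by
    ext n
    simp [expQuotient]
    rfl
  rw [h, ← map_mul, (eq_bernoulliFactor_iff 1 _).1 rfl, map_one]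

variable {Ω : Type*} [MeasurableSpace Ω] {P : Measure Ω}

theorem hasMomentSeries_of_hasLaw {L : Ω → ℝ} (hL : HasLaw L logisticMeasure P) :
    HasMomentSeries P (fun ω => Complex.I * (L ω : ℂ) - 1 / 2) (bernoulliFactor 1) := by
  have h := hasMomentSeries_logistic
  rw [← hL.map_eq] at h
  refine ⟨fun n => (h.1 n).comp_aemeasurable hL.aemeasurable, ?_⟩
  rw [← h.2]
  congr 1
  ext n
  exact (integral_map hL.aemeasurable (h.1 n).aestronglyMeasurable).symm

variable [IsProbabilityMeasure P] {k : ℕ} {L : Fin k → Ω → ℝ}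

theorem hasMomentSeries_norlundSeries (hlaw : ∀ j, HasLaw (L j) logisticMeasure P)
    (hindep : iIndepFun L P) (a : Fin k → ℂ) (x : ℂ) :
    HasMomentSeries P (fun ω => x + ∑ j, a j * (Complex.I * (L j ω : ℂ) - 1 / 2))
      (norlundSeries a x) := by
  refine (hasMomentSeries_const x).add (hasMomentSeries_sum (fun j => ?_) ?_ Finset.univ)
    (indepFun_const_left x _)
  · rw [← rescale_bernoulliFactor_one]
    exact (hasMomentSeries_of_hasLaw (hlaw j)).const_mul (a j)
  · exact hindep.comp (fun j (y : ℝ) => a j * (Complex.I * (y : ℂ) - 1 / 2))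
      fun j => measurable_I_mul_sub_half.const_mul _

/-- The moment representation of the Nörlund polynomials. -/
theorem norlundPoly_eq_integral (hlaw : ∀ j, HasLaw (L j) logisticMeasure P)
    (hindep : iIndepFun L P) (n : ℕ) (a : Fin k → ℂ) (x : ℂ) :
    norlundPoly n a x = ∫ ω, (x + ∑ j, a j * (Complex.I * (L j ω : ℂ) - 1 / 2)) ^ n ∂P := by
  have h := (hasMomentSeries_norlundSeries hlaw hindep a x).2
  rw [← egf_norlundPoly] at h
  exact (congrFun (egf_injective h) n).symm

/-- The norm is at most a constant plus `∑ |L j|`, and independence factors the exponential moment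
of that sum. -/
theorem integrable_exp_mul_norm_sum (hlaw : ∀ j, HasLaw (L j) logisticMeasure P)
    (hindep : iIndepFun L P) (x : ℂ) {A : ℝ} (hA0 : 0 ≤ A) (hA : A < 2 * Real.pi) :
    Integrable (fun ω => Real.exp
      (A * ‖x + ∑ j, 1 * (Complex.I * (L j ω : ℂ) - 1 / 2)‖)) P := by
  have hmeas : ∀ j, AEMeasurable (fun ω => |L j ω|) P := fun j =>
    (hlaw j).aemeasurable.abs
  have hi := integrable_exp_mul_sum_of_iIndepFun hmeas
    (hindep.comp (fun _ (y : ℝ) => |y|) fun _ => measurable_id.abs) (A := A) (fun j => by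
      have h := integrable_exp_mul_abs_logisticMeasure (A := A) (by rwa [abs_of_nonneg hA0])
      rw [← (hlaw j).map_eq] at h
      exact h.comp_aemeasurable (hlaw j).aemeasurable) Finset.univ
  refine (hi.mul_const (Real.exp (A * (‖x‖ + ∑ _j : Fin k, 1 / 2)))).mono' ?_
    (ae_of_all _ fun ω => ?_)
  · have hZ := (hasMomentSeries_norlundSeries hlaw hindep (fun _ => 1) x).aestronglyMeasurable
    exact Real.continuous_exp.comp_aestronglyMeasurable (hZ.norm.const_mul A)
  · rw [Real.norm_of_nonneg (Real.exp_pos _).le, ← Real.exp_add, ← mul_add]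
    gcongr
    refine (norm_add_le _ _).trans ?_
    rw [← add_assoc, add_comm _ ‖x‖, add_assoc, ← Finset.sum_add_distrib]
    gcongr
    refine (norm_sum_le _ _).trans (Finset.sum_le_sum fun j _ => ?_)
    rw [one_mul]
    exact norm_I_mul_sub_half_le _

end LogisticMoments

/-! ### Comparison of the two sides. -/

theorem hasMultiVolkenbornIntegral_powerSeries (p : ℕ) [Fact p.Prime] {K : Type*} [Field K]
    [CharZero K] (τ : K →+* PadicComplex p) {k : ℕ} (x : Fin k → K) (c : ℕ → K)
    (t : PadicComplex p)
    (ht : Tendsto (fun n => ‖τ (c n)‖ * (‖t‖ * max 1 ‖∑ j, τ (x j)‖) ^ n) atTop (𝓝 0)) :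
    ∃ v : PadicComplex p,
      HasMultiVolkenbornIntegral p k
        (fun y => ∑' n, τ (c n) * (t * ∑ j, (τ (x j) + padicIntToComplex p (y j))) ^ n) v ∧
      HasSum (fun n => τ (c n * norlundPoly n (fun _ : Fin k => 1) (∑ j, x j)) * t ^ n) v := by
  have hc : Tendsto (fun n => ‖τ (c n) * t ^ n‖ * (max 1 ‖∑ j, τ (x j)‖) ^ n) atTop (𝓝 0) := by
    refine ht.congr fun n => ?_
    rw [norm_mul, norm_pow, mul_pow, mul_assoc]
  refine ⟨∑' n, τ (c n) * t ^ n *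
    norlundPoly n (fun _ : Fin k => (1 : PadicComplex p)) (∑ j, τ (x j)), ?_, ?_⟩
  · have h := hasMultiVolkenbornIntegral_tsum p (le_max_left _ _) hc k (le_max_right _ _)
    convert! h using 4 with y n
    rw [Finset.sum_add_distrib, mul_pow, mul_assoc]
  · convert! (summable_mul_norlundPoly_one p (le_max_left _ _) hc k (le_max_right _ _)).hasSum using 2
      with n
    rw [map_mul, map_norlundPoly, map_sum]
    simp_rw [map_one]
    ring

theorem mainTheorem2 {Ω : Type*} [MeasurableSpace Ω] (P : Measure Ω) [IsProbabilityMeasure P]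
    (k : ℕ) (L : Fin k → Ω → ℝ) (hlaw : ∀ j, HasLaw (L j) logisticMeasure P)
    (hindep : iIndepFun L P) :
    -- moment representation of the Bernoulli polynomials of order `k` with parameter `a`
    (∀ (n : ℕ) (a : Fin k → ℝ) (x : ℝ),
      Integrable (fun ω => ((x : ℂ) + ∑ j, (a j : ℂ) * (Complex.I * (L j ω : ℂ) - 1 / 2)) ^ n) P ∧
      ((norlundPoly n a x : ℝ) : ℂ) =
        ∫ ω, ((x : ℂ) + ∑ j, (a j : ℂ) * (Complex.I * (L j ω : ℂ) - 1 / 2)) ^ n ∂P) ∧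
    -- moment representation of the Bernoulli numbers of order `k` with parameter `a`
    (∀ (n : ℕ) (a : Fin k → ℝ),
      Integrable (fun ω => (∑ j, (a j : ℂ) * (Complex.I * (L j ω : ℂ) - 1 / 2)) ^ n) P ∧
      ((norlundNumber n a : ℝ) : ℂ) =
        ∫ ω, (∑ j, (a j : ℂ) * (Complex.I * (L j ω : ℂ) - 1 / 2)) ^ n ∂P) ∧
    -- the multivariate Volkenborn integral of `y ↦ f (|x + y|)`
    (∀ (p : ℕ) [Fact p.Prime] (K : Type*) [Field K] (σ : K →+* ℂ) (τ : K →+* PadicComplex p)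
      (x : Fin k → K),
      -- for a polynomial `f`, both sides are (the images of) one and the same element of `K`
      (∀ f : Polynomial K, ∃ v : K,
        HasMultiVolkenbornIntegral p k
          (fun y => f.eval₂ τ (∑ j, (τ (x j) + padicIntToComplex p (y j)))) (τ v) ∧
        Integrable (fun ω => f.eval₂ σ (∑ j, (σ (x j) + Complex.I * (L j ω : ℂ) - 1 / 2))) P ∧
        ∫ ω, f.eval₂ σ (∑ j, (σ (x j) + Complex.I * (L j ω : ℂ) - 1 / 2)) ∂P = σ v) ∧
      -- for an analytic `f`, both sides for `u ↦ f (t u)` are given by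
      -- one and the same power series in `t` with coefficients in `K`
      (∀ f : K⟦X⟧, ∃ g : K⟦X⟧,
        (∀ t : PadicComplex p,
          Tendsto (fun n => ‖τ (f.coeff n)‖ * (‖t‖ * max 1 ‖∑ j, τ (x j)‖) ^ n) atTop (𝓝 0) →
          ∃ v : PadicComplex p,
            HasMultiVolkenbornIntegral p k
              (fun y => ∑' n : ℕ, τ (f.coeff n) *
                (t * ∑ j, (τ (x j) + padicIntToComplex p (y j))) ^ n) v ∧
            HasSum (fun n => τ (g.coeff n) * t ^ n) v) ∧
        (∀ t : ℂ,
          (∃ C A : ℝ, A < 2 * Real.pi ∧ ∀ n, (n ! : ℝ) * ‖σ (f.coeff n)‖ * ‖t‖ ^ n ≤ C * A ^ n) →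
          Integrable (fun ω => ∑' n : ℕ, σ (f.coeff n) *
            (t * ∑ j, (σ (x j) + Complex.I * (L j ω : ℂ) - 1 / 2)) ^ n) P ∧
          HasSum (fun n => σ (g.coeff n) * t ^ n)
            (∫ ω, ∑' n : ℕ, σ (f.coeff n) *
              (t * ∑ j, (σ (x j) + Complex.I * (L j ω : ℂ) - 1 / 2)) ^ n ∂P)))) := by
  have key : ∀ (n : ℕ) (a : Fin k → ℝ) (x : ℝ),
      Integrable (fun ω => ((x : ℂ) + ∑ j, (a j : ℂ) * (Complex.I * (L j ω : ℂ) - 1 / 2)) ^ n) P ∧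
      ((norlundPoly n a x : ℝ) : ℂ) =
        ∫ ω, ((x : ℂ) + ∑ j, (a j : ℂ) * (Complex.I * (L j ω : ℂ) - 1 / 2)) ^ n ∂P := by
    intro n a x
    refine ⟨(hasMomentSeries_norlundSeries hlaw hindep (fun j => (a j : ℂ)) x).1 n, ?_⟩
    rw [← norlundPoly_eq_integral hlaw hindep n (fun j => (a j : ℂ)) x]
    exact map_norlundPoly Complex.ofRealHom n a x
  refine ⟨key, fun n a => by simpa [norlundNumber] using key n a 0, ?_⟩
  intro p _ K _ σ τ x
  have : CharZero K := (RingHom.charZero_iff σ.injective).2 inferInstance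
  -- The common value in `K` of both sides for `f = u^n`.
  set b : ℕ → K := fun n => norlundPoly n (fun _ : Fin k => 1) (∑ j, x j) with hb
  have hX : ∀ ω, ∑ j, (σ (x j) + Complex.I * (L j ω : ℂ) - 1 / 2) =
      σ (∑ j, x j) + ∑ j, 1 * (Complex.I * (L j ω : ℂ) - 1 / 2) := by
    intro ω
    rw [map_sum, ← Finset.sum_add_distrib]
    exact Finset.sum_congr rfl fun j _ => by ring
  have hmom := hasMomentSeries_norlundSeries hlaw hindep (fun _ => 1) (σ (∑ j, x j))
  have hσb : ∀ n, σ (b n) = ∫ ω,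
      (σ (∑ j, x j) + ∑ j, 1 * (Complex.I * (L j ω : ℂ) - 1 / 2)) ^ n ∂P := by
    intro n
    rw [← norlundPoly_eq_integral hlaw hindep n (fun _ => 1), hb, map_norlundPoly]
    simp_rw [map_one]
  constructor
  · intro f
    have hzero : ∀ n ∉ Finset.range (f.natDegree + 1), f.coeff n = 0 := fun n hn =>
      Polynomial.coeff_eq_zero_of_natDegree_lt (by simpa using hn)
    refine ⟨∑ n ∈ Finset.range (f.natDegree + 1), f.coeff n * b n, ?_, ?_, ?_⟩
    -- A polynomial is a series with finitely many nonzero terms, so `t = 1` is admissible.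
    · obtain ⟨v, hv, hs⟩ := hasMultiVolkenbornIntegral_powerSeries p τ x f.coeff 1 (by
        refine tendsto_const_nhds.congr' ?_
        filter_upwards [eventually_gt_atTop f.natDegree] with n hn
        rw [Polynomial.coeff_eq_zero_of_natDegree_lt hn, map_zero, norm_zero, zero_mul])
      have hs' : HasSum (fun n => τ (f.coeff n * b n) * 1 ^ n)
          (∑ n ∈ Finset.range (f.natDegree + 1), τ (f.coeff n * b n) * 1 ^ n) :=
        hasSum_sum_of_ne_finset_zero fun n hn => by simp [hzero n hn]
      rw [hs.unique hs'] at hv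
      convert! hv using 1
      · ext y
        rw [Polynomial.eval₂_eq_sum_range, tsum_eq_sum (s := Finset.range (f.natDegree + 1))
          fun n hn => by simp [hzero n hn]]
        simp
      · simp
    · simp_rw [hX, Polynomial.eval₂_eq_sum_range]
      exact integrable_finsetSum _ fun n _ => (hmom.1 n).const_mul _
    · simp_rw [hX, Polynomial.eval₂_eq_sum_range]
      rw [integral_finsetSum _ fun n _ => (hmom.1 n).const_mul _,
        map_sum σ fun n => f.coeff n * b n]
      refine Finset.sum_congr rfl fun n _ => ?_
      rw [integral_const_mul, map_mul, hσb]
  · intro f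
    refine ⟨PowerSeries.mk fun n => f.coeff n * b n, fun t ht => ?_, ?_⟩
    · simp_rw [PowerSeries.coeff_mk]
      exact hasMultiVolkenbornIntegral_powerSeries p τ x (fun n => f.coeff n) t ht
    · rintro t ⟨C, A, hA, hc⟩
      have hC : 0 ≤ C := by simpa using (by positivity : (0 : ℝ) ≤ _).trans (hc 0)
      -- The exponential moment bound needs a nonnegative order. If `A < 0`, the case `n = 1` gives
      -- `0 ≤ C A`, which forces `C = 0`.
      have hc' : ∀ n, (n ! : ℝ) * ‖σ (f.coeff n) * t ^ n‖ ≤ C * (max A 0) ^ n := by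
        intro n
        rw [norm_mul, norm_pow, ← mul_assoc]
        refine (hc n).trans ?_
        rcases le_total 0 A with hA0 | hA0
        · rw [max_eq_left hA0]
        · have h1 := (by positivity : (0 : ℝ) ≤ _).trans (hc 1)
          rcases hA0.eq_or_lt with rfl | hA0
          · simp
          · have : C = 0 := by
              rw [pow_one] at h1
              nlinarith
            simp [this]
      have h := hasSum_integral_pow_of_integrable_exp hmom.aestronglyMeasurable
        (integrable_exp_mul_norm_sum hlaw hindep (σ (∑ j, x j)) (le_max_right A 0)
          (max_lt hA Real.two_pi_pos)) hc'
      have hterm : ∀ n ω, σ (f.coeff n) *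
          (t * ∑ j, (σ (x j) + Complex.I * (L j ω : ℂ) - 1 / 2)) ^ n = σ (f.coeff n) * t ^ n *
            (σ (∑ j, x j) + ∑ j, 1 * (Complex.I * (L j ω : ℂ) - 1 / 2)) ^ n := by
        intro n ω
        rw [hX, mul_pow, mul_assoc]
      simp_rw [hterm]
      refine ⟨h.1, ?_⟩
      convert! h.2 using 2 with n
      rw [PowerSeries.coeff_mk, map_mul, hσb]
      ring
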